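/- An affine plane is a set of points with a family of sets of points, the lines, such that two distinct points lie on exactly one line, through a point off a line $\ell$ there is exactly one line disjoint from $\ell$, and there are three non-collinear points. Lines are parallel ($\parallel$) if they are equal or disjoint. The plane is a *Desargues affine plane* if $AC\parallel A'C'$ whenever $A\ne A'$, $B\ne B'$, $C\ne C'$, each of the triples $A,B,C$ and $A',B',C'$ consists of distinct points, the lines $AA',BB',CC'$ are distinct and either parallel or through a common point, $AB\parallel A'B'$ and $BC\parallel B'C'$. Let $O\neq I$ be points of a Desargues affine plane and let $\ell^{OI}$ be the line through them. It is a skew field with zero $O$ and unit $I$ under the following operations, in which $B_1$ is any point off $\ell^{OI}$ (the results do not depend on it) and $\ell^{X}_{m}$ is the parallel to the line $m$ through $X$: * $A+B$ is the point $\ell^{P_1}_{BB_1}\cap \ell^{OI}$, where $P_1=\ell^{B_1}_{OI}\cap \ell^{A}_{OB_1}$; * $A\cdot B$ is the point $\ell^{P_1}_{BB_1}\cap \ell^{OI}$, where $P_1=\ell^{A}_{IB_1}\cap \ell^{OB_1}$. For $A,B,C,D\in\ell^{OI}$, no three of them equal, the cross-ratio is $$c_r^{OI}(A,B;C,D)=\left[(A-D)^{-1}(B-D)\right]\left[(B-C)^{-1}(A-C)\right]$$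 in this skew field, with the convention $O^{-1}=\infty$; so it is a point of $\ell^{OI}$ if $A\ne D$ and $B\neq C$, and it is $\infty$ otherwise. A dilatation is a bijection $\delta$ of the points that maps lines to lines and every line $PQ$ to a line parallel to $PQ$; put $\delta(\infty)=\infty$. **Theorem.** Let $\delta$ be a dilatation, $O'=\delta(O)$ and $I'=\delta(I)$. Then $\delta$ maps $\ell^{OI}$ onto the line $\ell^{O'I'}$, which is parallel to $\ell^{OI}$, and which is $\ell^{OI}$ itself if $\delta$ has a fixed point on $\ell^{OI}$. For all $A,B\in\ell^{OI}$ one has $\delta(A+B)=\delta(A)+\delta(B)$ and $\delta(A\cdot B)=\delta(A)\cdot\delta(B)$, where the operations on the right are those of the line with zero $O'$ and unit $I'$; that is, $\delta$ is an isomorphism of the skew field on $\ell^{OI}$ with zero $O$ and unit $I$ onto the skew field on $\ell^{O'I'}$ with zero $O'$ and unit $I'$. For all $A,B,C,D\in\ell^{OI}$, no three of them equal, $$\delta\left(c_r^{OI}(A,B;C,D)\right)=c_r^{O'I'}\left(\delta(A),\delta(B);\delta(C),\delta(D)\right).$$ In particular this holds for every dilatation with a fixed point on $\ell^{OI}$.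 -/

import Mathlib

/-- An affine plane on the set `P` of points: lines are sets of points. -/
class AffinePlane (P : Type*) where
  /-- the family of lines -/
  lines : Set (Set P)
  /-- two distinct points lie on exactly one line -/
  join : ∀ A B : P, A ≠ B → ∃! l : Set P, l ∈ lines ∧ A ∈ l ∧ B ∈ l
  /-- through a point off a line there is exactly one line that misses it -/
  playfair : ∀ (A : P) (l : Set P), l ∈ lines → A ∉ l →
    ∃! m : Set P, m ∈ lines ∧ A ∈ m ∧ l ∩ m = ∅
  /-- there are three non-collinear points -/
  noncollinear : ∃ A B C : P, A ≠ B ∧ A ≠ C ∧ B ≠ C ∧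
    ∀ l ∈ lines, ¬ (A ∈ l ∧ B ∈ l ∧ C ∈ l)

namespace AffinePlane

/-- Two lines are parallel if they are equal or disjoint. -/
def Parallel {P : Type*} (l m : Set P) : Prop := l = m ∨ l ∩ m = ∅

variable {P : Type*} [AffinePlane P]

/-- The line through two points `A ≠ B` (see `line_mem` and `line_eq`). -/
def line (A B : P) : Set P := {X | ∀ l ∈ lines (P := P), A ∈ l → B ∈ l → X ∈ l}

theorem line_eq {A B : P} (h : A ≠ B) {l : Set P} (hl : l ∈ lines (P := P))
    (hA : A ∈ l) (hB : B ∈ l) : line A B = l := by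
  ext X
  constructor
  · intro hX
    exact hX l hl hA hB
  · intro hX m hm hAm hBm
    have := (join A B h).unique ⟨hm, hAm, hBm⟩ ⟨hl, hA, hB⟩
    rwa [this]

theorem line_mem {A B : P} (h : A ≠ B) : line A B ∈ lines (P := P) := by
  obtain ⟨l, ⟨hl, hA, hB⟩, -⟩ := join A B h
  rwa [line_eq h hl hA hB]

/-- The line through the point `A` parallel to the line `l` (see `parallelThrough_spec`). -/
def parallelThrough (A : P) (l : Set P) : Set P :=
  {X | ∃ m ∈ lines (P := P), A ∈ m ∧ Parallel l m ∧ X ∈ m}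

theorem existsUnique_parallel (A : P) {l : Set P} (hl : l ∈ lines (P := P)) :
    ∃! m : Set P, m ∈ lines (P := P) ∧ A ∈ m ∧ Parallel l m := by
  by_cases hA : A ∈ l
  · refine ⟨l, ⟨hl, hA, Or.inl rfl⟩, ?_⟩
    rintro m ⟨-, hAm, h | h⟩
    · exact h.symm
    · exact absurd (show A ∈ l ∩ m from ⟨hA, hAm⟩) (by simp [h])
  · obtain ⟨m, ⟨hm, hAm, hd⟩, hu⟩ := playfair A l hl hA
    refine ⟨m, ⟨hm, hAm, Or.inr hd⟩, ?_⟩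
    rintro k ⟨hk, hAk, h | h⟩
    · exact absurd (h ▸ hAk) hA
    · exact hu k ⟨hk, hAk, h⟩

theorem parallelThrough_spec (A : P) {l : Set P} (hl : l ∈ lines (P := P)) :
    parallelThrough A l ∈ lines (P := P) ∧ A ∈ parallelThrough A l ∧
      Parallel l (parallelThrough A l) := by
  obtain ⟨m, ⟨hm, hA, hp⟩, hu⟩ := existsUnique_parallel A hl
  have : parallelThrough A l = m := by
    ext X
    constructor
    · rintro ⟨k, hk, hAk, hpk, hX⟩
      exact hu k ⟨hk, hAk, hpk⟩ ▸ hX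
    · intro hX
      exact ⟨m, hm, hA, hp, hX⟩
  rw [this]
  exact ⟨hm, hA, hp⟩

/-- A dilatation: a collineation (a bijection of the points under which lines correspond to
lines) that sends every line to a parallel line. -/
structure IsDilatation (δ : P ≃ P) : Prop where
  collineation : ∀ l : Set P, δ '' l ∈ lines (P := P) ↔ l ∈ lines (P := P)
  parallel : ∀ A B : P, A ≠ B → Parallel (δ '' line A B) (line A B)

/-- `C` is obtained from `A` and `B` by the addition algorithm on the line `OI`, for some
auxiliary point `B₁` off that line. -/
def IsSum (O I A B C : P) : Prop :=
  ∃ B₁ P₁ : P, B₁ ∉ line O I ∧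
    P₁ ∈ parallelThrough B₁ (line O I) ∧ P₁ ∈ parallelThrough A (line O B₁) ∧
    C ∈ parallelThrough P₁ (line B B₁) ∧ C ∈ line O I

/-- `C` is obtained from `A` and `B` by the multiplication algorithm on the line `OI`, for some
auxiliary point `B₁` off that line. -/
def IsProd (O I A B C : P) : Prop :=
  ∃ B₁ P₁ : P, B₁ ∉ line O I ∧
    P₁ ∈ parallelThrough A (line I B₁) ∧ P₁ ∈ line O B₁ ∧
    C ∈ parallelThrough P₁ (line B B₁) ∧ C ∈ line O I

instance : Nonempty P := ⟨(noncollinear (P := P)).choose⟩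

/-- The sum `A + B` of points of the line `OI` (with zero `O`). -/
noncomputable def add (O I A B : P) : P := Classical.epsilon fun C => IsSum O I A B C

/-- The product `A · B` of points of the line `OI` (with zero `O` and unit `I`). -/
noncomputable def mul (O I A B : P) : P := Classical.epsilon fun C => IsProd O I A B C

/-- The opposite `-A` of a point of the line `OI`. -/
noncomputable def neg (O I A : P) : P :=
  Classical.epsilon fun X => X ∈ line O I ∧ add O I A X = O

/-- The difference `A - B` of points of the line `OI`. -/
noncomputable def sub (O I A B : P) : P := add O I A (neg O I B)

/-- The inverse `A⁻¹` of a point `A ≠ O` of the line `OI`. -/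
noncomputable def inv (O I A : P) : P :=
  Classical.epsilon fun X => X ∈ line O I ∧ mul O I A X = I

/-- No three of the four points are equal. -/
def NoThreeEqual (A B C D : P) : Prop :=
  ¬ (A = B ∧ B = C) ∧ ¬ (A = B ∧ B = D) ∧ ¬ (A = C ∧ C = D) ∧ ¬ (B = C ∧ C = D)

open Classical in
/-- The cross-ratio `[(A - D)⁻¹ (B - D)] [(B - C)⁻¹ (A - C)]`, computed on the line `OI`, of four
points of that line, no three of them equal. It is a point of the line, except that it is `∞`
if `A = D` or `B = C`, because `O⁻¹ = ∞` (the other factors are then not `O`). -/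
noncomputable def crossRatio (O I A B C D : P) : OnePoint P :=
  if A = D ∨ B = C then OnePoint.infty
  else OnePoint.some
    (mul O I
      (mul O I (inv O I (sub O I A D)) (sub O I B D))
      (mul O I (inv O I (sub O I B C)) (sub O I A C)))

end AffinePlane

open AffinePlane in
/-- A Desargues affine plane. The three lines `AA'`, `BB'`, `CC'` are distinct, and either
parallel or concurrent. -/
class DesarguesAffinePlane (P : Type*) extends AffinePlane P where
  desargues : ∀ A B C A' B' C' : P,
    A ≠ A' → B ≠ B' → C ≠ C' →
    A ≠ B → B ≠ C → A ≠ C → A' ≠ B' → B' ≠ C' → A' ≠ C' →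
    line A A' ≠ line B B' → line B B' ≠ line C C' → line A A' ≠ line C C' →
    ((Parallel (line A A') (line B B') ∧ Parallel (line B B') (line C C') ∧
        Parallel (line A A') (line C C')) ∨
      ∃ S : P, S ∈ line A A' ∧ S ∈ line B B' ∧ S ∈ line C C') →
    Parallel (line A B) (line A' B') → Parallel (line B C) (line B' C') →
    Parallel (line A C) (line A' C')

open AffinePlane

/-! A dilatation carries lines to lines and, being injective, disjoint lines to disjoint lines. So
it carries the figure that constructs `A + B` or `A · B` from an auxiliary point `X` to the figure
for the image points, with auxiliary point `δ X`. Since the outcome does not depend on the auxiliary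
point, `δ` commutes with both operations. Opposites and inverses are unique solutions of equations,
so `δ` commutes with them too, and hence with the cross-ratio.

The work lies in the independence of the auxiliary point: `SumWith.unique` and `ProdWith.unique`.
Both rest on `eq_of_desargues`, which applies Desargues twice to three lines that are parallel (sum)
or pass through `O` (product). It needs `X` and `X'` on different lines of the pencil; otherwise
both are compared with a third point `Z`. -/

namespace AffinePlane

/-! ### Incidence and parallels; the two constructions as relations. -/

section Incidence

variable {P : Type*}

theorem Parallel.symm {l m : Set P} (h : Parallel l m) : Parallel m l :=
  h.imp Eq.symm fun h => by rwa [Set.inter_comm]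

theorem Parallel.eq_of_mem {l m : Set P} (h : Parallel l m) {X : P} (hl : X ∈ l) (hm : X ∈ m) :
    l = m := by
  rcases h with h | h
  · exact h
  · exact absurd (show X ∈ l ∩ m from ⟨hl, hm⟩) (by simp [h])

variable [AffinePlane P]

theorem left_mem_line (A B : P) : A ∈ line A B := fun _ _ h _ => h

theorem right_mem_line (A B : P) : B ∈ line A B := fun _ _ _ h => h

theorem line_comm (A B : P) : line A B = line B A :=
  Set.ext fun _ => ⟨fun h l hl a b => h l hl b a, fun h l hl a b => h l hl b a⟩

theorem Parallel.trans {l m n : Set P} (hl : l ∈ lines (P := P)) (hm : m ∈ lines (P := P))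
    (hn : n ∈ lines (P := P)) (h : Parallel l m) (h' : Parallel m n) : Parallel l n := by
  by_cases hd : l ∩ n = ∅
  · exact Or.inr hd
  · obtain ⟨X, hXl, hXn⟩ := Set.nonempty_iff_ne_empty.2 hd
    exact Or.inl ((existsUnique_parallel X hm).unique ⟨hl, hXl, h.symm⟩ ⟨hn, hXn, h'⟩)

theorem eq_parallelThrough {A : P} {l m : Set P} (hl : l ∈ lines (P := P))
    (hm : m ∈ lines (P := P)) (hA : A ∈ m) (h : Parallel l m) : m = parallelThrough A l :=
  (existsUnique_parallel A hl).unique ⟨hm, hA, h⟩ (parallelThrough_spec A hl)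

theorem mem_parallelThrough_comm {A X : P} {l : Set P}
    (h : X ∈ parallelThrough A l) : A ∈ parallelThrough X l := by
  obtain ⟨m, hm, hA, hp, hX⟩ := h
  exact ⟨m, hm, hX, hp, hA⟩

theorem mem_parallelThrough_line_iff {A B X Y : P} (hXY : X ≠ Y) :
    Y ∈ parallelThrough X (line A B) ↔ Parallel (line A B) (line X Y) := by
  constructor
  · rintro ⟨m, hm, hX, hp, hY⟩
    rwa [line_eq hXY hm hX hY]
  · intro h
    exact ⟨_, line_mem hXY, left_mem_line X Y, h, right_mem_line X Y⟩

theorem mem_parallelThrough_line_swap {A B X Y : P} (hAB : A ≠ B) (hXY : X ≠ Y)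
    (h : Y ∈ parallelThrough X (line A B)) : B ∈ parallelThrough A (line X Y) :=
  (mem_parallelThrough_line_iff hAB).2 ((mem_parallelThrough_line_iff hXY).1 h).symm

/-- A line that meets `AB` in `A` alone meets every parallel to `AB`. -/
theorem exists_mem_parallelThrough {A B : P} {l : Set P} (hl : l ∈ lines (P := P)) (hA : A ∈ l)
    (hB : B ∉ l) (X : P) : ∃ Y ∈ l, Y ∈ parallelThrough X (line A B) := by
  have hAB : A ≠ B := fun h => hB (h ▸ hA)
  obtain ⟨hm, -, hp⟩ := parallelThrough_spec X (line_mem hAB)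
  by_contra! hne
  have hd : Parallel (parallelThrough X (line A B)) l :=
    Or.inr (Set.eq_empty_iff_forall_notMem.2 fun Y hY => hne Y hY.2 hY.1)
  have := (hp.trans (line_mem hAB) hm hl hd).eq_of_mem (left_mem_line A B) hA
  exact hB (this ▸ right_mem_line A B)

/-- A line that meets `AB` in `A` alone meets a parallel to `AB` in at most one point. -/
theorem eq_of_mem_parallelThrough {A B : P} {l : Set P} (hl : l ∈ lines (P := P)) (hA : A ∈ l)
    (hB : B ∉ l) {X Y Z : P} (hY : Y ∈ l) (hZ : Z ∈ l)
    (hY' : Y ∈ parallelThrough X (line A B)) (hZ' : Z ∈ parallelThrough X (line A B)) :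
    Y = Z := by
  by_contra hYZ
  have hAB : A ≠ B := fun h => hB (h ▸ hA)
  obtain ⟨hm, -, hp⟩ := parallelThrough_spec X (line_mem hAB)
  have h : parallelThrough X (line A B) = l :=
    (line_eq hYZ hm hY' hZ').symm.trans (line_eq hYZ hl hY hZ)
  rw [h] at hp
  exact hB (hp.eq_of_mem (left_mem_line A B) hA ▸ right_mem_line A B)

theorem eq_of_mem_line {A B : P} {l : Set P} (hl : l ∈ lines (P := P)) (hA : A ∈ l)
    (hB : B ∉ l) {X : P} (hX : X ∈ l) (hX' : X ∈ line A B) : X = A := by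
  by_contra h
  have hAB : A ≠ B := fun h => hB (h ▸ hA)
  have : line A B = l := (line_eq h (line_mem hAB) hX' (left_mem_line A B)).symm.trans
    (line_eq h hl hX hA)
  exact hB (this ▸ right_mem_line A B)

theorem not_mem_parallelThrough {A X : P} {l : Set P} (hl : l ∈ lines (P := P)) (hX : X ∉ l)
    (hA : A ∈ l) : A ∉ parallelThrough X l := by
  obtain ⟨-, hXm, hp⟩ := parallelThrough_spec X hl
  exact fun h => hX (hp.eq_of_mem hA h ▸ hXm)

theorem exists_not_mem {l : Set P} (hl : l ∈ lines (P := P)) : ∃ X, X ∉ l := by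
  obtain ⟨A, B, C, -, -, -, h⟩ := noncollinear (P := P)
  by_contra! hne
  exact h l hl ⟨hne A, hne B, hne C⟩

/-- A third point on the line `AB` gives a point of `AX` other than `A` and `X`. -/
theorem exists_mem_line_ne {A B C X : P} {l : Set P} (hl : l ∈ lines (P := P)) (hA : A ∈ l)
    (hB : B ∈ l) (hC : C ∈ l) (hAB : A ≠ B) (hAC : A ≠ C) (hBC : B ≠ C) (hX : X ∉ l) :
    ∃ Y ∈ line A X, Y ≠ A ∧ Y ≠ X := by
  have hAX : A ≠ X := fun h => hX (h ▸ hA)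
  have hBX : B ≠ X := fun h => hX (h ▸ hB)
  have hBn : B ∉ line A X := fun h => hAB (eq_of_mem_line hl hA hX hB h).symm
  -- `Y` is the projection of `C` to `AX` along the direction of `BX`; `A` and `X` are the
  -- projections of `A` and `B`.
  obtain ⟨Y, hY, hY'⟩ := exists_mem_parallelThrough (line_mem hAX) (right_mem_line A X) hBn C
  rw [line_comm] at hY'
  have hCC := (parallelThrough_spec C (line_mem hBX)).2.1
  refine ⟨Y, hY, ?_, ?_⟩
  · rintro rfl
    exact hAC (eq_of_mem_parallelThrough hl hB hX hA hC hY' hCC)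
  · rintro rfl
    have h := mem_parallelThrough_comm hY'
    have := (parallelThrough_spec Y (line_mem hBX)).2.2.eq_of_mem (right_mem_line B Y)
      (parallelThrough_spec Y (line_mem hBX)).2.1
    rw [← this] at h
    exact hBC (eq_of_mem_line hl hB hX hC h).symm

/-- `C` is the sum of `A` and `B`, constructed with the auxiliary points `X` and `Y`. -/
def SumWith (O I A B C X Y : P) : Prop :=
  Y ∈ parallelThrough X (line O I) ∧ Y ∈ parallelThrough A (line O X) ∧
    C ∈ parallelThrough Y (line B X) ∧ C ∈ line O I

/-- `C` is the product of `A` and `B`, constructed with the auxiliary points `X` and `Y`. -/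
def ProdWith (O I A B C X Y : P) : Prop :=
  Y ∈ parallelThrough A (line I X) ∧ Y ∈ line O X ∧
    C ∈ parallelThrough Y (line B X) ∧ C ∈ line O I

theorem exists_sumWith {O I A B X : P} (hOI : O ≠ I) (hB : B ∈ line O I) (hX : X ∉ line O I) :
    ∃ C Y, SumWith O I A B C X Y := by
  have hl := line_mem hOI
  obtain ⟨hm, hXm, -⟩ := parallelThrough_spec X hl
  obtain ⟨Y, hY, hY'⟩ := exists_mem_parallelThrough hm hXm
    (not_mem_parallelThrough hl hX (left_mem_line O I)) A
  rw [line_comm] at hY'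
  obtain ⟨C, hC, hC'⟩ := exists_mem_parallelThrough hl hB hX Y
  exact ⟨C, Y, hY, hY', hC', hC⟩

theorem exists_prodWith {O I A B X : P} (hOI : O ≠ I) (hB : B ∈ line O I) (hX : X ∉ line O I) :
    ∃ C Y, ProdWith O I A B C X Y := by
  have hl := line_mem hOI
  have hOX : O ≠ X := fun h => hX (h ▸ left_mem_line O I)
  have hI : I ∉ line O X := fun h => hOI
    (eq_of_mem_line hl (left_mem_line O I) hX (right_mem_line O I) h).symm
  obtain ⟨Y, hY, hY'⟩ := exists_mem_parallelThrough (line_mem hOX) (right_mem_line O X) hI A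
  rw [line_comm] at hY'
  obtain ⟨C, hC, hC'⟩ := exists_mem_parallelThrough hl hB hX Y
  exact ⟨C, Y, hY', hY, hC', hC⟩

theorem SumWith.isSum {O I A B C X Y : P} (h : SumWith O I A B C X Y) (hX : X ∉ line O I) :
    IsSum O I A B C := ⟨X, Y, hX, h⟩

theorem ProdWith.isProd {O I A B C X Y : P} (h : ProdWith O I A B C X Y) (hX : X ∉ line O I) :
    IsProd O I A B C := ⟨X, Y, hX, h⟩

theorem SumWith.not_mem {O I A B C X Y : P} (h : SumWith O I A B C X Y) (hOI : O ≠ I)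
    (hX : X ∉ line O I) : Y ∉ line O I := fun hY =>
  not_mem_parallelThrough (line_mem hOI) hX hY h.1

theorem ProdWith.not_mem {O I A B C X Y : P} (h : ProdWith O I A B C X Y) (hOI : O ≠ I)
    (hA : A ∈ line O I) (hAO : A ≠ O) (hX : X ∉ line O I) : Y ∉ line O I := by
  intro hY
  have hl := line_mem hOI
  have hIX : I ≠ X := fun h => hX (h ▸ right_mem_line O I)
  obtain rfl := eq_of_mem_line hl (left_mem_line O I) hX hY h.2.1
  exact hAO (eq_of_mem_parallelThrough hl (right_mem_line _ I) hX hA hY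
    (parallelThrough_spec A (line_mem hIX)).2.1 h.1)

/-- `Y` is built without the second summand, so a single `Y` serves for all of them. -/
theorem SumWith.aux_unique {O I A B B' C C' X Y Y' : P} (h : SumWith O I A B C X Y)
    (h' : SumWith O I A B' C' X Y') (hOI : O ≠ I) (hX : X ∉ line O I) : Y = Y' := by
  have hl := line_mem hOI
  obtain ⟨hm, hXm, -⟩ := parallelThrough_spec X hl
  have h1 := h.2.1
  have h2 := h'.2.1
  rw [line_comm] at h1 h2
  exact eq_of_mem_parallelThrough hm hXm
    (not_mem_parallelThrough hl hX (left_mem_line O I)) h.1 h'.1 h1 h2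

theorem ProdWith.aux_unique {O I A B B' C C' X Y Y' : P} (h : ProdWith O I A B C X Y)
    (h' : ProdWith O I A B' C' X Y') (hOI : O ≠ I) (hX : X ∉ line O I) : Y = Y' := by
  have hl := line_mem hOI
  have hOX : O ≠ X := fun h => hX (h ▸ left_mem_line O I)
  have hI : I ∉ line O X := fun h => hOI
    (eq_of_mem_line hl (left_mem_line O I) hX (right_mem_line O I) h).symm
  have h1 := h.1
  have h2 := h'.1
  rw [line_comm] at h1 h2
  exact eq_of_mem_parallelThrough (line_mem hOX) (right_mem_line O X) hI h.2.1 h'.2.1 h1 h2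

theorem parallelThrough_line_self {A B X : P} (hAB : A ≠ B) (hX : X ∈ line A B) :
    parallelThrough X (line A B) = line A B :=
  (eq_parallelThrough (line_mem hAB) (line_mem hAB) hX (Or.inl rfl)).symm

theorem parallelThrough_eq_of_mem {A X : P} {l : Set P} (hl : l ∈ lines (P := P))
    (h : X ∈ parallelThrough A l) : parallelThrough X l = parallelThrough A l := by
  obtain ⟨hm, -, hp⟩ := parallelThrough_spec A hl
  exact (eq_parallelThrough hl hm h hp).symm

end Incidence

/-! ### Desargues' theorem in terms of points on three given lines. -/

section Desargues

variable {P : Type*} [DesarguesAffinePlane P]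

/-- Desargues' theorem for triangles with corresponding vertices on three given lines. -/
theorem desargues_of_mem {l m n : Set P} (hl : l ∈ lines (P := P)) (hm : m ∈ lines (P := P))
    (hn : n ∈ lines (P := P)) (hlm : l ≠ m) (hmn : m ≠ n) (hln : l ≠ n)
    (hpc : (Parallel l m ∧ Parallel m n ∧ Parallel l n) ∨ ∃ S, S ∈ l ∧ S ∈ m ∧ S ∈ n)
    {A B C A' B' C' : P} (hA : A ∈ l) (hA' : A' ∈ l) (hB : B ∈ m) (hB' : B' ∈ m)
    (hC : C ∈ n) (hC' : C' ∈ n) (hAA : A ≠ A') (hBB : B ≠ B') (hCC : C ≠ C')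
    (hAB : A ≠ B) (hBC : B ≠ C) (hAC : A ≠ C) (hAB' : A' ≠ B') (hBC' : B' ≠ C') (hAC' : A' ≠ C')
    (h1 : B' ∈ parallelThrough A' (line A B)) (h2 : C' ∈ parallelThrough B' (line B C)) :
    C' ∈ parallelThrough A' (line A C) := by
  have el := line_eq hAA hl hA hA'
  have em := line_eq hBB hm hB hB'
  have en := line_eq hCC hn hC hC'
  rw [mem_parallelThrough_line_iff hAC']
  refine DesarguesAffinePlane.desargues A B C A' B' C' hAA hBB hCC hAB hBC hAC hAB' hBC' hAC'
    ?_ ?_ ?_ ?_ ((mem_parallelThrough_line_iff hAB').1 h1)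
    ((mem_parallelThrough_line_iff hBC').1 h2)
  · rwa [el, em]
  · rwa [em, en]
  · rwa [el, en]
  · rwa [el, em, en]

end Desargues

end AffinePlane

namespace AffinePlane

/-! ### Independence of the auxiliary point. -/

section Desargues

variable {P : Type*} [DesarguesAffinePlane P]

/-- Two translations, or two homotheties, of a line `l` that agree at `E` agree at `B`. -/
theorem eq_of_desargues {l m n : Set P} (hl : l ∈ lines (P := P)) (hm : m ∈ lines (P := P))
    (hn : n ∈ lines (P := P)) (hlm : l ≠ m) (hmn : m ≠ n) (hln : l ≠ n)
    (hpc : (Parallel l m ∧ Parallel m n ∧ Parallel l n) ∨ ∃ S, S ∈ l ∧ S ∈ m ∧ S ∈ n)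
    {E A B C C' X Y X' Y' : P} (hE : E ∈ l) (hA : A ∈ l) (hB : B ∈ l) (hC : C ∈ l) (hC' : C' ∈ l)
    (hXm : X ∈ m) (hYm : Y ∈ m) (hXn : X' ∈ n) (hYn : Y' ∈ n)
    (hX : X ∉ l) (hY : Y ∉ l) (hX' : X' ∉ l) (hY' : Y' ∉ l)
    (hEA : E ≠ A) (hBC : B ≠ C) (hXY : X ≠ Y) (hXY' : X' ≠ Y') (hXX : X ≠ X') (hYY : Y ≠ Y')
    (h1 : Y ∈ parallelThrough A (line E X)) (h2 : C ∈ parallelThrough Y (line B X))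
    (h1' : Y' ∈ parallelThrough A (line E X')) (h2' : C' ∈ parallelThrough Y' (line B X')) :
    C = C' := by
  have ne : ∀ {U V : P}, U ∈ l → V ∉ l → U ≠ V := fun hU hV h => hV (h ▸ hU)
  -- Triangles `X E X'` and `Y A Y'`.
  have h3 : Y' ∈ parallelThrough Y (line X X') := by
    refine desargues_of_mem hm hl hn hlm.symm hln hmn
      (hpc.imp (fun h => ⟨h.1.symm, h.2.2, h.2.1⟩) fun ⟨S, h⟩ => ⟨S, h.2.1, h.1, h.2.2⟩)
      hXm hYm hE hA hXn hYn hXY hEA hXY' (ne hE hX).symm (ne hE hX') hXX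
      (ne hA hY).symm (ne hA hY') hYY ?_ h1'
    rw [line_comm]
    exact mem_parallelThrough_comm h1
  -- Triangles `B X X'` and `C Y Y'`; then `C` and `C'` are both the point where the parallel to
  -- `BX'` through `Y'` meets `l`.
  have h4 : Y' ∈ parallelThrough C (line B X') :=
    desargues_of_mem hl hm hn hlm hmn hln hpc hB hC hXm hYm hXn hYn hBC hXY hXY'
      (ne hB hX) hXX (ne hB hX') (ne hC hY) hYY (ne hC hY') (mem_parallelThrough_comm h2) h3
  exact eq_of_mem_parallelThrough hl hB hX' hC hC' (mem_parallelThrough_comm h4) h2'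

variable {O I A B C C' X Y X' Y' : P}

theorem SumWith.eq_of_zero_left (h : SumWith O I O B C X Y) (hOI : O ≠ I) (hB : B ∈ line O I)
    (hX : X ∉ line O I) : C = B := by
  have hl := line_mem hOI
  have hOX : O ≠ X := fun h => hX (h ▸ left_mem_line O I)
  have hBX : B ≠ X := fun h => hX (h ▸ hB)
  have h0 := h.2.1
  rw [parallelThrough_line_self hOX (left_mem_line O X)] at h0
  obtain ⟨hm, hXm, -⟩ := parallelThrough_spec X hl
  rw [line_comm] at h0
  obtain rfl := eq_of_mem_line hm hXm
    (not_mem_parallelThrough hl hX (left_mem_line O I)) h.1 h0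
  have h3 := h.2.2.1
  rw [parallelThrough_line_self hBX (right_mem_line B Y)] at h3
  exact eq_of_mem_line hl hB hX h.2.2.2 h3

theorem SumWith.eq_of_zero_right (h : SumWith O I A O C X Y) (hOI : O ≠ I) (hA : A ∈ line O I)
    (hX : X ∉ line O I) : C = A := by
  have hl := line_mem hOI
  have hOX : O ≠ X := fun h => hX (h ▸ left_mem_line O I)
  have h3 := h.2.2.1
  rw [parallelThrough_eq_of_mem (line_mem hOX) h.2.1] at h3
  exact eq_of_mem_parallelThrough hl (left_mem_line O I) hX h.2.2.2 hA h3
    (parallelThrough_spec A (line_mem hOX)).2.1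

theorem SumWith.aux_ne (h : SumWith O I A B C X Y) (hOI : O ≠ I) (hA : A ∈ line O I)
    (hX : X ∉ line O I) (hAO : A ≠ O) : X ≠ Y := by
  rintro rfl
  have hOX : O ≠ X := fun h => hX (h ▸ left_mem_line O I)
  have h0 := mem_parallelThrough_comm h.2.1
  rw [parallelThrough_line_self hOX (right_mem_line O X)] at h0
  exact hAO (eq_of_mem_line (line_mem hOI) (left_mem_line O I) hX hA h0)

theorem SumWith.ne_right (h : SumWith O I A B C X Y) (hOI : O ≠ I) (hA : A ∈ line O I)
    (hB : B ∈ line O I) (hX : X ∉ line O I) (hAO : A ≠ O) : B ≠ C := by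
  rintro rfl
  have hl := line_mem hOI
  have hBX : B ≠ X := fun h => hX (h ▸ hB)
  have h0 := mem_parallelThrough_comm h.2.2.1
  rw [parallelThrough_line_self hBX (left_mem_line B X), line_comm] at h0
  obtain ⟨hm, hXm, -⟩ := parallelThrough_spec X hl
  exact h.aux_ne hOI hA hX hAO
    (eq_of_mem_line hm hXm (not_mem_parallelThrough hl hX hB) h.1 h0).symm

/-- Desargues for `OI` and its parallels through `X` and `X'`: both figures give translations taking
`O` to `A`. -/
theorem SumWith.eq_of_not_mem (h : SumWith O I A B C X Y) (h' : SumWith O I A B C' X' Y')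
    (hOI : O ≠ I) (hA : A ∈ line O I) (hB : B ∈ line O I)
    (hX : X ∉ line O I) (hX' : X' ∉ line O I) (hAO : A ≠ O)
    (hXX : X' ∉ parallelThrough X (line O I)) : C = C' := by
  have hl := line_mem hOI
  obtain ⟨hm, hXm, hp⟩ := parallelThrough_spec X hl
  obtain ⟨hn, hXn, hq⟩ := parallelThrough_spec X' hl
  have hmn : parallelThrough X (line O I) ≠ parallelThrough X' (line O I) :=
    fun e => hXX (e ▸ hXn)
  refine eq_of_desargues hl hm hn (fun e => hX (e ▸ hXm)) hmn (fun e => hX' (e ▸ hXn))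
    (Or.inl ⟨hp, hp.symm.trans hm hl hn hq, hq⟩) (left_mem_line O I) hA hB h.2.2.2 h'.2.2.2
    hXm h.1 hXn h'.1 hX (h.not_mem hOI hX) hX' (h'.not_mem hOI hX') hAO.symm
    (h.ne_right hOI hA hB hX hAO) (h.aux_ne hOI hA hX hAO) (h'.aux_ne hOI hA hX' hAO)
    (fun e => hXX (e ▸ hXm)) ?_ h.2.1 h.2.2.1 h'.2.1 h'.2.2.1
  rintro rfl
  exact hmn ((parallelThrough_eq_of_mem hl h.1).symm.trans (parallelThrough_eq_of_mem hl h'.1))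

theorem SumWith.unique (h : SumWith O I A B C X Y) (h' : SumWith O I A B C' X' Y')
    (hOI : O ≠ I) (hA : A ∈ line O I) (hB : B ∈ line O I)
    (hX : X ∉ line O I) (hX' : X' ∉ line O I) : C = C' := by
  have hl := line_mem hOI
  -- For `A = O` one has `Y = X` and the triangles degenerate; `B ≠ O` is used below to find a third
  -- point of `OI`.
  by_cases hAO : A = O
  · subst hAO
    rw [h.eq_of_zero_left hOI hB hX, h'.eq_of_zero_left hOI hB hX']
  by_cases hBO : B = O
  · subst hBO
    rw [h.eq_of_zero_right hOI hA hX, h'.eq_of_zero_right hOI hA hX']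
  by_cases hXX : X' ∈ parallelThrough X (line O I)
  -- If lines have only two points, no `Z` exists off both `OI` and its parallel through `X`. But if
  -- `C ≠ C'`, one of them is a third point of `OI` besides `O` and `B`, and this yields `Z` on
  -- `OX`.
  · by_contra hCC
    obtain ⟨D, hD, hDO, hDB⟩ : ∃ D ∈ line O I, O ≠ D ∧ B ≠ D := by
      by_cases hCO : O = C
      · exact ⟨C', h'.2.2.2, fun e => hCC (hCO.symm.trans e), h'.ne_right hOI hA hB hX' hAO⟩
      · exact ⟨C, h.2.2.2, hCO, h.ne_right hOI hA hB hX hAO⟩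
    obtain ⟨Z, hZ, hZO, hZX⟩ := exists_mem_line_ne hl (left_mem_line O I) hB hD
      (Ne.symm hBO) hDO hDB hX
    have hZl : Z ∉ line O I := fun hZl =>
      hZO (eq_of_mem_line hl (left_mem_line O I) hX hZl hZ)
    obtain ⟨hm, hXm, -⟩ := parallelThrough_spec X hl
    have hZm : Z ∉ parallelThrough X (line O I) := fun hZm => by
      rw [line_comm] at hZ
      exact hZX (eq_of_mem_line hm hXm
        (not_mem_parallelThrough hl hX (left_mem_line O I)) hZm hZ)
    obtain ⟨E, W, hE⟩ := exists_sumWith (A := A) hOI hB hZl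
    refine hCC ((h.eq_of_not_mem hE hOI hA hB hX hZl hAO hZm).trans
      (h'.eq_of_not_mem hE hOI hA hB hX' hZl hAO ?_).symm)
    rwa [parallelThrough_eq_of_mem hl hXX]
  · exact h.eq_of_not_mem h' hOI hA hB hX hX' hAO hXX

theorem ProdWith.eq_of_zero_left (h : ProdWith O I O B C X Y) (hOI : O ≠ I) (hB : B ∈ line O I)
    (hX : X ∉ line O I) : C = O := by
  have hl := line_mem hOI
  have hIX : I ≠ X := fun h => hX (h ▸ right_mem_line O I)
  have hOX : O ≠ X := fun h => hX (h ▸ left_mem_line O I)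
  have hI : I ∉ line O X := fun h => hOI
    (eq_of_mem_line hl (left_mem_line O I) hX (right_mem_line O I) h).symm
  have hY : Y = O := by
    have h1 := h.1
    have h2 := (parallelThrough_spec O (line_mem hIX)).2.1
    rw [line_comm] at h1 h2
    exact eq_of_mem_parallelThrough (line_mem hOX) (right_mem_line O X) hI h.2.1
      (left_mem_line O X) h1 h2
  subst hY
  have hBX : B ≠ X := fun h => hX (h ▸ hB)
  exact eq_of_mem_parallelThrough hl hB hX h.2.2.2 (left_mem_line Y I) h.2.2.1
    (parallelThrough_spec Y (line_mem hBX)).2.1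

theorem ProdWith.eq_of_zero_right (h : ProdWith O I A O C X Y) (hOI : O ≠ I)
    (hX : X ∉ line O I) : C = O := by
  have hOX : O ≠ X := fun h => hX (h ▸ left_mem_line O I)
  have h3 := h.2.2.1
  rw [parallelThrough_line_self hOX h.2.1] at h3
  exact eq_of_mem_line (line_mem hOI) (left_mem_line O I) hX h.2.2.2 h3

theorem ProdWith.eq_of_one_left (h : ProdWith O I I B C X Y) (hOI : O ≠ I) (hB : B ∈ line O I)
    (hX : X ∉ line O I) : C = B := by
  have hl := line_mem hOI
  have hIX : I ≠ X := fun h => hX (h ▸ right_mem_line O I)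
  have hOX : O ≠ X := fun h => hX (h ▸ left_mem_line O I)
  have hBX : B ≠ X := fun h => hX (h ▸ hB)
  have hI : I ∉ line O X := fun h => hOI
    (eq_of_mem_line hl (left_mem_line O I) hX (right_mem_line O I) h).symm
  have h1 := h.1
  rw [parallelThrough_line_self hIX (left_mem_line I X), line_comm] at h1
  obtain rfl := eq_of_mem_line (line_mem hOX) (right_mem_line O X) hI h.2.1 h1
  have h3 := h.2.2.1
  rw [parallelThrough_line_self hBX (right_mem_line B Y)] at h3
  exact eq_of_mem_line hl hB hX h.2.2.2 h3

theorem ProdWith.aux_ne (h : ProdWith O I A B C X Y) (hOI : O ≠ I) (hA : A ∈ line O I)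
    (hX : X ∉ line O I) (hAI : A ≠ I) : X ≠ Y := by
  rintro rfl
  have hIX : I ≠ X := fun h => hX (h ▸ right_mem_line O I)
  have h0 := mem_parallelThrough_comm h.1
  rw [parallelThrough_line_self hIX (right_mem_line I X)] at h0
  exact hAI (eq_of_mem_line (line_mem hOI) (right_mem_line O I) hX hA h0)

theorem ProdWith.ne_right (h : ProdWith O I A B C X Y) (hOI : O ≠ I) (hA : A ∈ line O I)
    (hB : B ∈ line O I) (hX : X ∉ line O I) (hAI : A ≠ I) (hBO : B ≠ O) : B ≠ C := by
  rintro rfl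
  have hOX : O ≠ X := fun h => hX (h ▸ left_mem_line O I)
  have hBX : B ≠ X := fun h => hX (h ▸ hB)
  have h0 := mem_parallelThrough_comm h.2.2.1
  rw [parallelThrough_line_self hBX (left_mem_line B X), line_comm] at h0
  have hBn : B ∉ line O X := fun h => hBO
    (eq_of_mem_line (line_mem hOI) (left_mem_line O I) hX hB h)
  exact h.aux_ne hOI hA hX hAI
    (eq_of_mem_line (line_mem hOX) (right_mem_line O X) hBn h.2.1 h0).symm

/-- Desargues for three lines through `O`: both figures give homotheties with centre `O` taking `I`
to `A`. -/
theorem ProdWith.eq_of_not_mem (h : ProdWith O I A B C X Y) (h' : ProdWith O I A B C' X' Y')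
    (hOI : O ≠ I) (hA : A ∈ line O I) (hB : B ∈ line O I)
    (hX : X ∉ line O I) (hX' : X' ∉ line O I) (hAO : A ≠ O) (hAI : A ≠ I) (hBO : B ≠ O)
    (hXX : X' ∉ line O X) : C = C' := by
  have hl := line_mem hOI
  have hOX : O ≠ X := fun h => hX (h ▸ left_mem_line O I)
  have hOX' : O ≠ X' := fun h => hX' (h ▸ left_mem_line O I)
  refine eq_of_desargues hl (line_mem hOX) (line_mem hOX')
    (fun e => hX (e ▸ right_mem_line O X)) (fun e => hXX (e ▸ right_mem_line O X'))
    (fun e => hX' (e ▸ right_mem_line O X'))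
    (Or.inr ⟨O, left_mem_line O I, left_mem_line O X, left_mem_line O X'⟩)
    (right_mem_line O I) hA hB h.2.2.2 h'.2.2.2
    (right_mem_line O X) h.2.1 (right_mem_line O X') h'.2.1 hX (h.not_mem hOI hA hAO hX) hX'
    (h'.not_mem hOI hA hAO hX') hAI.symm (h.ne_right hOI hA hB hX hAI hBO)
    (h.aux_ne hOI hA hX hAI) (h'.aux_ne hOI hA hX' hAI)
    (fun e => hXX (e ▸ right_mem_line O X)) ?_ h.1 h.2.2.1 h'.1 h'.2.2.1
  rintro rfl
  have := eq_of_mem_line (line_mem hOX) (left_mem_line O X) hXX h.2.1 h'.2.1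
  exact h.not_mem hOI hA hAO hX (this ▸ left_mem_line O I)

theorem ProdWith.unique (h : ProdWith O I A B C X Y) (h' : ProdWith O I A B C' X' Y')
    (hOI : O ≠ I) (hA : A ∈ line O I) (hB : B ∈ line O I)
    (hX : X ∉ line O I) (hX' : X' ∉ line O I) : C = C' := by
  have hl := line_mem hOI
  -- Desargues degenerates when `A = O` (`Y = O`), `A = I` (`Y = X`) or `B = O` (`C = B`).
  by_cases hAO : A = O
  · subst hAO
    rw [h.eq_of_zero_left hOI hB hX, h'.eq_of_zero_left hOI hB hX']
  by_cases hAI : A = I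
  · subst hAI
    rw [h.eq_of_one_left hOI hB hX, h'.eq_of_one_left hOI hB hX']
  by_cases hBO : B = O
  · subst hBO
    rw [h.eq_of_zero_right hOI hX, h'.eq_of_zero_right hOI hX']
  by_cases hXX : X' ∈ line O X
  · have hOX : O ≠ X := fun h => hX (h ▸ left_mem_line O I)
    have hOX' : O ≠ X' := fun h => hX' (h ▸ left_mem_line O I)
    obtain ⟨hm, hXm, -⟩ := parallelThrough_spec X hl
    have hIn : I ∉ line O X := fun h => hOI
      (eq_of_mem_line hl (left_mem_line O I) hX (right_mem_line O I) h).symm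
    have hOm := not_mem_parallelThrough hl hX (left_mem_line O I)
    -- The fourth vertex of the parallelogram `O I Z X` exists even if lines have only two points.
    obtain ⟨Z, hZ, hZI⟩ := exists_mem_parallelThrough hm hXm hOm I
    rw [line_comm] at hZI
    have hZl : Z ∉ line O I := fun e => not_mem_parallelThrough hl hX e hZ
    have hZn : Z ∉ line O X := fun e =>
      not_mem_parallelThrough (line_mem hOX) hIn e hZI
    obtain ⟨E, W, hE⟩ := exists_prodWith (A := A) hOI hB hZl
    refine (h.eq_of_not_mem hE hOI hA hB hX hZl hAO hAI hBO hZn).trans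
      (h'.eq_of_not_mem hE hOI hA hB hX' hZl hAO hAI hBO ?_).symm
    rwa [line_eq hOX' (line_mem hOX) (left_mem_line O X) hXX]
  · exact h.eq_of_not_mem h' hOI hA hB hX hX' hAO hAI hBO hXX

end Desargues

end AffinePlane

namespace AffinePlane

/-! ### The operations as functions, and solving equations. -/

section Operations

variable {P : Type*} [DesarguesAffinePlane P] {O I A B C D : P}

theorem existsUnique_isSum (hOI : O ≠ I) (hA : A ∈ line O I) (hB : B ∈ line O I) :
    ∃! C, IsSum O I A B C := by
  obtain ⟨X, hX⟩ := exists_not_mem (line_mem hOI)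
  obtain ⟨C, Y, h⟩ := exists_sumWith (A := A) hOI hB hX
  refine ⟨C, h.isSum hX, ?_⟩
  rintro C' ⟨X', Y', hX', h'⟩
  exact SumWith.unique h' h hOI hA hB hX' hX

theorem existsUnique_isProd (hOI : O ≠ I) (hA : A ∈ line O I) (hB : B ∈ line O I) :
    ∃! C, IsProd O I A B C := by
  obtain ⟨X, hX⟩ := exists_not_mem (line_mem hOI)
  obtain ⟨C, Y, h⟩ := exists_prodWith (A := A) hOI hB hX
  refine ⟨C, h.isProd hX, ?_⟩
  rintro C' ⟨X', Y', hX', h'⟩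
  exact ProdWith.unique h' h hOI hA hB hX' hX

theorem isSum_iff (hOI : O ≠ I) (hA : A ∈ line O I) (hB : B ∈ line O I) :
    IsSum O I A B C ↔ add O I A B = C := by
  have hu := existsUnique_isSum hOI hA hB
  have hs : IsSum O I A B (add O I A B) := Classical.epsilon_spec hu.exists
  exact ⟨fun h => hu.unique hs h, fun h => h ▸ hs⟩

theorem isProd_iff (hOI : O ≠ I) (hA : A ∈ line O I) (hB : B ∈ line O I) :
    IsProd O I A B C ↔ mul O I A B = C := by
  have hu := existsUnique_isProd hOI hA hB
  have hs : IsProd O I A B (mul O I A B) := Classical.epsilon_spec hu.exists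
  exact ⟨fun h => hu.unique hs h, fun h => h ▸ hs⟩

theorem add_mem (hOI : O ≠ I) (hA : A ∈ line O I) (hB : B ∈ line O I) :
    add O I A B ∈ line O I := by
  obtain ⟨_, _, _, _, _, _, h⟩ := (isSum_iff hOI hA hB).2 rfl
  exact h

theorem mul_mem (hOI : O ≠ I) (hA : A ∈ line O I) (hB : B ∈ line O I) :
    mul O I A B ∈ line O I := by
  obtain ⟨_, _, _, _, _, _, h⟩ := (isProd_iff hOI hA hB).2 rfl
  exact h

theorem exists_sumWith_add {X : P} (hOI : O ≠ I) (hA : A ∈ line O I) (hB : B ∈ line O I)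
    (hX : X ∉ line O I) : ∃ Y, SumWith O I A B (add O I A B) X Y := by
  obtain ⟨C, Y, h⟩ := exists_sumWith (A := A) hOI hB hX
  exact ⟨Y, (isSum_iff hOI hA hB).1 (h.isSum hX) ▸ h⟩

theorem exists_prodWith_mul {X : P} (hOI : O ≠ I) (hA : A ∈ line O I) (hB : B ∈ line O I)
    (hX : X ∉ line O I) : ∃ Y, ProdWith O I A B (mul O I A B) X Y := by
  obtain ⟨C, Y, h⟩ := exists_prodWith (A := A) hOI hB hX
  exact ⟨Y, (isProd_iff hOI hA hB).1 (h.isProd hX) ▸ h⟩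

/-- The construction runs backwards: the sum and `B` determine `Y`, and `Y` determines `A`. -/
theorem add_right_cancel (hOI : O ≠ I) (hA : A ∈ line O I) (hB : B ∈ line O I)
    (hD : D ∈ line O I) (h : add O I A B = add O I D B) : A = D := by
  have hl := line_mem hOI
  obtain ⟨X, hX⟩ := exists_not_mem hl
  obtain ⟨Y, hY⟩ := exists_sumWith_add hOI hA hB hX
  obtain ⟨Z, hZ⟩ := exists_sumWith_add hOI hD hB hX
  rw [← h] at hZ
  have h1 := mem_parallelThrough_comm hY.2.2.1
  have h2 := mem_parallelThrough_comm hZ.2.2.1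
  rw [line_comm] at h1 h2
  obtain ⟨hm, hXm, -⟩ := parallelThrough_spec X hl
  obtain rfl := eq_of_mem_parallelThrough hm hXm (not_mem_parallelThrough hl hX hB)
    hY.1 hZ.1 h1 h2
  exact eq_of_mem_parallelThrough hl (left_mem_line O I) hX hA hD
    (mem_parallelThrough_comm hY.2.1) (mem_parallelThrough_comm hZ.2.1)

/-- The second vertex of a translated or stretched triangle is determined by the others. -/
theorem existsUnique_mem_parallelThrough {l : Set P} {X Y : P} (hl : l ∈ lines (P := P))
    (hC : C ∈ l) (hX : X ∉ l) (hY : Y ∉ l) :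
    ∃! B, B ∈ l ∧ C ∈ parallelThrough Y (line B X) := by
  have hYC : Y ≠ C := fun e => hY (e ▸ hC)
  -- This puts `B` on a line that does not depend on `B`.
  have key : ∀ B ∈ l, C ∈ parallelThrough Y (line B X) ↔ B ∈ parallelThrough X (line C Y) := by
    intro B hB
    have hXB : X ≠ B := fun e => hX (e ▸ hB)
    rw [line_comm B, line_comm C]
    exact ⟨mem_parallelThrough_line_swap hXB hYC, mem_parallelThrough_line_swap hYC hXB⟩
  obtain ⟨B, hB, hB'⟩ := exists_mem_parallelThrough hl hC hY X
  refine ⟨B, ⟨hB, (key B hB).2 hB'⟩, ?_⟩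
  rintro B' ⟨hB1, hB2⟩
  exact eq_of_mem_parallelThrough hl hC hY hB1 hB ((key B' hB1).1 hB2) hB'

/-- Existence makes the choice in `neg` meaningful; uniqueness makes dilatations commute with it. -/
theorem existsUnique_add_eq (hOI : O ≠ I) (hA : A ∈ line O I) (hC : C ∈ line O I) :
    ∃! B, B ∈ line O I ∧ add O I A B = C := by
  have hl := line_mem hOI
  obtain ⟨X, hX⟩ := exists_not_mem hl
  obtain ⟨_, Y, hY⟩ := exists_sumWith (A := A) hOI hA hX
  obtain ⟨B, ⟨hB, hBC⟩, hu⟩ := existsUnique_mem_parallelThrough hl hC hX (hY.not_mem hOI hX)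
  refine ⟨B, ⟨hB, (isSum_iff hOI hA hB).1 ⟨X, Y, hX, hY.1, hY.2.1, hBC, hC⟩⟩, ?_⟩
  rintro B' ⟨hB', h⟩
  obtain ⟨Z, hZ⟩ := exists_sumWith_add hOI hA hB' hX
  obtain rfl := hY.aux_unique hZ hOI hX
  exact hu B' ⟨hB', h ▸ hZ.2.2.1⟩

theorem existsUnique_mul_eq (hOI : O ≠ I) (hA : A ∈ line O I) (hAO : A ≠ O)
    (hC : C ∈ line O I) : ∃! B, B ∈ line O I ∧ mul O I A B = C := by
  have hl := line_mem hOI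
  obtain ⟨X, hX⟩ := exists_not_mem hl
  obtain ⟨_, Y, hY⟩ := exists_prodWith (A := A) hOI hA hX
  obtain ⟨B, ⟨hB, hBC⟩, hu⟩ :=
    existsUnique_mem_parallelThrough hl hC hX (hY.not_mem hOI hA hAO hX)
  refine ⟨B, ⟨hB, (isProd_iff hOI hA hB).1 ⟨X, Y, hX, hY.1, hY.2.1, hBC, hC⟩⟩, ?_⟩
  rintro B' ⟨hB', h⟩
  obtain ⟨Z, hZ⟩ := exists_prodWith_mul hOI hA hB' hX
  obtain rfl := hY.aux_unique hZ hOI hX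
  exact hu B' ⟨hB', h ▸ hZ.2.2.1⟩

theorem neg_spec (hOI : O ≠ I) (hA : A ∈ line O I) :
    neg O I A ∈ line O I ∧ add O I A (neg O I A) = O :=
  Classical.epsilon_spec (existsUnique_add_eq hOI hA (left_mem_line O I)).exists

theorem inv_spec (hOI : O ≠ I) (hA : A ∈ line O I) (hAO : A ≠ O) :
    inv O I A ∈ line O I ∧ mul O I A (inv O I A) = I :=
  Classical.epsilon_spec (existsUnique_mul_eq hOI hA hAO (right_mem_line O I)).exists

theorem sub_mem (hOI : O ≠ I) (hA : A ∈ line O I) (hB : B ∈ line O I) :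
    sub O I A B ∈ line O I :=
  add_mem hOI hA (neg_spec hOI hB).1

/-- Ensures that the two inverses in a finite cross-ratio are genuine. -/
theorem sub_ne_zero (hOI : O ≠ I) (hA : A ∈ line O I) (hB : B ∈ line O I) (hAB : A ≠ B) :
    sub O I A B ≠ O := fun h =>
  hAB (add_right_cancel hOI hA (neg_spec hOI hB).1 hB (h.trans (neg_spec hOI hB).2.symm))

end Operations

/-! ### Dilatations transport the constructions. -/

section Collineation

variable {P : Type*} [AffinePlane P] {δ : P ≃ P}

/-- `line A B` is the intersection of all lines through both points, so the case `A = B` needs no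
separate treatment. -/
theorem IsDilatation.image_line (hδ : IsDilatation δ) (A B : P) :
    δ '' line A B = line (δ A) (δ B) := by
  ext X
  constructor
  · rintro ⟨Y, hY, rfl⟩ l hl hA hB
    have := hY (δ ⁻¹' l) ((hδ.collineation _).1 (by rwa [δ.image_preimage])) hA hB
    exact this
  · intro hX
    refine ⟨δ.symm X, fun l hl hA hB => ?_, δ.apply_symm_apply X⟩
    obtain ⟨Y, hY, rfl⟩ := hX (δ '' l) ((hδ.collineation l).2 hl) ⟨A, hA, rfl⟩ ⟨B, hB, rfl⟩
    rwa [δ.symm_apply_apply]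

theorem IsDilatation.mem_line_iff (hδ : IsDilatation δ) {A B X : P} :
    δ X ∈ line (δ A) (δ B) ↔ X ∈ line A B := by
  rw [← hδ.image_line, δ.injective.mem_set_image]

theorem IsDilatation.mem_parallelThrough (hδ : IsDilatation δ) {A X : P} {l : Set P}
    (h : X ∈ parallelThrough A l) : δ X ∈ parallelThrough (δ A) (δ '' l) := by
  obtain ⟨m, hm, hA, hp, hX⟩ := h
  refine ⟨δ '' m, (hδ.collineation m).2 hm, ⟨A, hA, rfl⟩, ?_, ⟨X, hX, rfl⟩⟩
  refine hp.imp (fun h => by rw [h]) fun h => ?_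
  rw [← Set.image_inter δ.injective, h, Set.image_empty]

theorem IsDilatation.isSum (hδ : IsDilatation δ) {O I A B C : P} (h : IsSum O I A B C) :
    IsSum (δ O) (δ I) (δ A) (δ B) (δ C) := by
  obtain ⟨X, Y, hX, h1, h2, h3, h4⟩ := h
  refine ⟨δ X, δ Y, fun h => hX (hδ.mem_line_iff.1 h), ?_, ?_, ?_, hδ.mem_line_iff.2 h4⟩ <;>
    rw [← hδ.image_line] <;> exact hδ.mem_parallelThrough ‹_›

theorem IsDilatation.isProd (hδ : IsDilatation δ) {O I A B C : P} (h : IsProd O I A B C) :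
    IsProd (δ O) (δ I) (δ A) (δ B) (δ C) := by
  obtain ⟨X, Y, hX, h1, h2, h3, h4⟩ := h
  refine ⟨δ X, δ Y, fun h => hX (hδ.mem_line_iff.1 h), ?_, hδ.mem_line_iff.2 h2, ?_,
    hδ.mem_line_iff.2 h4⟩ <;>
    rw [← hδ.image_line] <;> exact hδ.mem_parallelThrough ‹_›

end Collineation

/-! ### Dilatations commute with the operations and the cross-ratio. -/

section DilatationOperations

variable {P : Type*} [DesarguesAffinePlane P] {δ : P ≃ P} {O I A B C D : P}

theorem IsDilatation.map_add (hδ : IsDilatation δ) (hOI : O ≠ I) (hA : A ∈ line O I)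
    (hB : B ∈ line O I) : δ (add O I A B) = add (δ O) (δ I) (δ A) (δ B) :=
  ((isSum_iff (δ.injective.ne hOI) (hδ.mem_line_iff.2 hA) (hδ.mem_line_iff.2 hB)).1
    (hδ.isSum ((isSum_iff hOI hA hB).2 rfl))).symm

theorem IsDilatation.map_mul (hδ : IsDilatation δ) (hOI : O ≠ I) (hA : A ∈ line O I)
    (hB : B ∈ line O I) : δ (mul O I A B) = mul (δ O) (δ I) (δ A) (δ B) :=
  ((isProd_iff (δ.injective.ne hOI) (hδ.mem_line_iff.2 hA) (hδ.mem_line_iff.2 hB)).1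
    (hδ.isProd ((isProd_iff hOI hA hB).2 rfl))).symm

theorem IsDilatation.map_neg (hδ : IsDilatation δ) (hOI : O ≠ I) (hA : A ∈ line O I) :
    δ (neg O I A) = neg (δ O) (δ I) (δ A) := by
  have hOI' := δ.injective.ne hOI
  have hA' := hδ.mem_line_iff.2 hA
  obtain ⟨h1, h2⟩ := neg_spec hOI hA
  exact (existsUnique_add_eq hOI' hA' (left_mem_line _ _)).unique
    ⟨hδ.mem_line_iff.2 h1, by rw [← hδ.map_add hOI hA h1, h2]⟩ (neg_spec hOI' hA')

theorem IsDilatation.map_inv (hδ : IsDilatation δ) (hOI : O ≠ I) (hA : A ∈ line O I)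
    (hAO : A ≠ O) : δ (inv O I A) = inv (δ O) (δ I) (δ A) := by
  have hOI' := δ.injective.ne hOI
  have hA' := hδ.mem_line_iff.2 hA
  have hAO' := δ.injective.ne hAO
  obtain ⟨h1, h2⟩ := inv_spec hOI hA hAO
  exact (existsUnique_mul_eq hOI' hA' hAO' (right_mem_line _ _)).unique
    ⟨hδ.mem_line_iff.2 h1, by rw [← hδ.map_mul hOI hA h1, h2]⟩ (inv_spec hOI' hA' hAO')

theorem IsDilatation.map_sub (hδ : IsDilatation δ) (hOI : O ≠ I) (hA : A ∈ line O I)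
    (hB : B ∈ line O I) : δ (sub O I A B) = sub (δ O) (δ I) (δ A) (δ B) := by
  rw [sub, sub, hδ.map_add hOI hA (neg_spec hOI hB).1, hδ.map_neg hOI hB]

theorem IsDilatation.map_crossRatio (hδ : IsDilatation δ) (hOI : O ≠ I) (hA : A ∈ line O I)
    (hB : B ∈ line O I) (hC : C ∈ line O I) (hD : D ∈ line O I) :
    OnePoint.map δ (crossRatio O I A B C D) =
      crossRatio (δ O) (δ I) (δ A) (δ B) (δ C) (δ D) := by
  by_cases h : A = D ∨ B = C
  · rw [crossRatio, crossRatio, if_pos h, if_pos (h.imp (congrArg δ) (congrArg δ)),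
      OnePoint.map_infty]
  · have h' : ¬ (δ A = δ D ∨ δ B = δ C) := by simpa using h
    obtain ⟨hAD, hBC⟩ := not_or.1 h
    have h1 := sub_mem hOI hA hD
    have h2 := sub_mem hOI hB hC
    have h3 := sub_ne_zero hOI hA hD hAD
    have h4 := sub_ne_zero hOI hB hC hBC
    have h5 := (inv_spec hOI h1 h3).1
    have h6 := (inv_spec hOI h2 h4).1
    have h7 := sub_mem hOI hB hD
    have h8 := sub_mem hOI hA hC
    rw [crossRatio, crossRatio, if_neg h, if_neg h', OnePoint.map_some,
      hδ.map_mul hOI (mul_mem hOI h5 h7) (mul_mem hOI h6 h8), hδ.map_mul hOI h5 h7,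
      hδ.map_mul hOI h6 h8, hδ.map_inv hOI h1 h3, hδ.map_inv hOI h2 h4, hδ.map_sub hOI hA hD,
      hδ.map_sub hOI hB hD, hδ.map_sub hOI hB hC, hδ.map_sub hOI hA hC]

end DilatationOperations

end AffinePlane

theorem mainTheorem4 {P : Type*} [DesarguesAffinePlane P] (O I : P) (hOI : O ≠ I)
    (δ : P ≃ P) (hδ : IsDilatation δ) :
    -- the line `OI` goes onto the parallel line `δ(O)δ(I)`
    (δ '' line O I = line (δ O) (δ I) ∧ Parallel (line (δ O) (δ I)) (line O I)) ∧
    -- and onto itself if it contains a fixed point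
    ((∃ F ∈ line O I, δ F = F) → δ '' line O I = line O I) ∧
    -- `δ` respects addition and multiplication of points
    (∀ A ∈ line O I, ∀ B ∈ line O I,
      δ (add O I A B) = add (δ O) (δ I) (δ A) (δ B) ∧
      δ (mul O I A B) = mul (δ O) (δ I) (δ A) (δ B)) ∧
    -- `δ` preserves the cross-ratio
    (∀ A ∈ line O I, ∀ B ∈ line O I, ∀ C ∈ line O I, ∀ D ∈ line O I,
      NoThreeEqual A B C D →
      OnePoint.map δ (crossRatio O I A B C D) =
        crossRatio (δ O) (δ I) (δ A) (δ B) (δ C) (δ D)) := by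
  refine ⟨⟨hδ.image_line O I, hδ.image_line O I ▸ hδ.parallel O I hOI⟩, ?_, ?_, ?_⟩
  · rintro ⟨F, hF, hFF⟩
    exact (hδ.parallel O I hOI).eq_of_mem ⟨F, hF, hFF⟩ hF
  · exact fun A hA B hB => ⟨hδ.map_add hOI hA hB, hδ.map_mul hOI hA hB⟩
  · exact fun A hA B hB C hC D hD _ => hδ.map_crossRatio hOI hA hB hC hD
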